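/- Let $(R,\mathfrak m,k)$ be a one-dimensional (Noetherian) Cohen–Macaulay local ring with infinite residue field $k$ whose associated graded ring $\operatorname{Gr}_{\mathfrak m}(R)=\bigoplus_{n\ge 0}\mathfrak m^n/\mathfrak m^{n+1}$ is Cohen–Macaulay. Let $\operatorname{Gll}(R)$ be the smallest positive integer $n$ such that $\mathfrak m^n$ is contained in an ideal generated by a system of parameters of $R$; call a nonzerodivisor $x\in\mathfrak m$ a witness to $\operatorname{Gll}(R)$ if $\mathfrak m^{\operatorname{Gll}(R)}\subseteq xR$. Let $\operatorname{ulr}(R)$ be the smallest integer $s\ge 0$ such that $\mathfrak m^s$ is Ulrich, that is, such that its minimal number of generators $\mu(\mathfrak m^s)$ equals the Hilbert–Samuel multiplicity $e(R)$. Then the following hold. 1. There is a witness $x\in\mathfrak m$ to $\operatorname{Gll}(R)$ such that $xR$ is a reduction of $\mathfrak m$, i.e. $\mathfrak m^{n+1}=x\mathfrak m^n$ for some $n\ge 0$, and the reduction number of $\mathfrak m$ with respect to $xR$, i.e. the least such $n$, equals $\operatorname{ulr}(R)$. 2. The set of witnesses to $\operatorname{Gll}(R)$ in the $k$-vector space $\mathfrak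 m/\mathfrak m^2$ contains a non-empty Zariski-open set: there is a non-empty Zariski-open subset $U\subseteq\mathfrak m/\mathfrak m^2$ such that every $x\in\mathfrak m$ whose class in $\mathfrak m/\mathfrak m^2$ lies in $U$ is a witness to $\operatorname{Gll}(R)$. -/

import Mathlib

open IsLocalRing

universe u

/-- The Krull dimension as a natural number (used only for rings of finite dimension). -/
noncomputable def krullDimNat (R : Type u) [CommRing R] : ℕ :=
  ((ringKrullDim R).unbotD 0).toNat

/-- A local ring `R` is a Cohen-Macaulay local ring if it is Noetherian and its maximal ideal
contains a regular sequence of length `dim R`, i.e. `depth R = dim R`. -/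
structure IsCMLocalRing (R : Type u) [CommRing R] [IsLocalRing R] : Prop where
  noetherian : IsNoetherianRing R
  exists_regular : ∃ rs : List R, (rs.length : WithBot ℕ∞) = ringKrullDim R ∧
    (∀ r ∈ rs, r ∈ maximalIdeal R) ∧ RingTheory.Sequence.IsRegular R rs

/-- A commutative ring is Cohen-Macaulay if it is Noetherian and all its localizations at maximal
ideals are Cohen-Macaulay local rings. -/
structure IsCMRing (A : Type u) [CommRing A] : Prop where
  noetherian : IsNoetherianRing A
  localization : ∀ (P : Ideal A) [P.IsMaximal], IsCMLocalRing (Localization.AtPrime P)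

/-- The associated graded ring `Gr_I(R) = ⨁ I ^ n / I ^ (n + 1)`, presented as `R[It] / I R[It]`,
where `R[It] = ⨁ I ^ n t ^ n` is the Rees algebra. -/
abbrev AssocGradedRing {R : Type u} [CommRing R] (I : Ideal R) : Type u :=
  reesAlgebra I ⧸ I.map (algebraMap R (reesAlgebra I))

/-- The Hilbert-Samuel multiplicity `e(R) = lim d! ℓ(R / m ^ n) / n ^ d`, where `d = dim R`. -/
noncomputable def hilbertSamuelMultiplicity (R : Type u) [CommRing R] [IsLocalRing R] : ℝ :=
  Filter.limUnder Filter.atTop fun n : ℕ =>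
    ((krullDimNat R).factorial : ℝ) * ((Module.length R (R ⧸ maximalIdeal R ^ n)).toNat : ℝ) /
      (n : ℝ) ^ krullDimNat R

/-- A system of parameters of a local ring: `dim R` elements generating an ideal whose radical is
the maximal ideal. -/
structure IsSystemOfParameters {R : Type u} [CommRing R] [IsLocalRing R] (rs : List R) : Prop where
  length_eq : (rs.length : WithBot ℕ∞) = ringKrullDim R
  radical_eq : (Ideal.ofList rs).radical = maximalIdeal R

/-- The generalized Loewy length: the least positive `n` such that `m ^ n` is contained in the
ideal generated by some system of parameters. -/
noncomputable def gll (R : Type u) [CommRing R] [IsLocalRing R] : ℕ :=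
  sInf {n | 0 < n ∧ ∃ rs : List R, IsSystemOfParameters rs ∧ maximalIdeal R ^ n ≤ Ideal.ofList rs}

/-- A witness to `gll R`: a regular sequence of length `dim R` in the maximal ideal that generates
an ideal containing `m ^ (gll R)`. -/
structure IsGllWitness {R : Type u} [CommRing R] [IsLocalRing R] (rs : List R) : Prop where
  length_eq : (rs.length : WithBot ℕ∞) = ringKrullDim R
  mem : ∀ r ∈ rs, r ∈ maximalIdeal R
  regular : RingTheory.Sequence.IsRegular R rs
  pow_le : maximalIdeal R ^ gll R ≤ Ideal.ofList rs

/-- An ideal that is `m`-primary or the unit ideal is Ulrich (as a module) if its minimal number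
of generators equals the multiplicity of the ring. -/
structure IsUlrichIdeal {R : Type u} [CommRing R] [IsLocalRing R] (I : Ideal R) : Prop where
  le_radical : maximalIdeal R ≤ I.radical
  generators_eq : (Submodule.spanFinrank I : ℝ) = hilbertSamuelMultiplicity R

/-- The Ulrich index: the least `s ≥ 0` such that `m ^ s` is Ulrich. -/
noncomputable def ulr (R : Type u) [CommRing R] [IsLocalRing R] : ℕ :=
  sInf {s | IsUlrichIdeal (maximalIdeal R ^ s)}

/-- `J` is a reduction of `I`. -/
def IsReduction {R : Type u} [CommRing R] (J I : Ideal R) : Prop :=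
  J ≤ I ∧ ∃ n : ℕ, I ^ (n + 1) = J * I ^ n

/-- The reduction number of `I` with respect to a reduction `J` of `I`. -/
noncomputable def reductionNumber {R : Type u} [CommRing R] (J I : Ideal R) : ℕ :=
  sInf {n | J * I ^ n = I ^ (n + 1)}

/-- The `k`-algebra of polynomial functions on a vector space: the functions generated by the
constants and the linear forms. -/
def vectorSpacePolynomialFunctions (k V : Type u) [Field k] [AddCommGroup V] [Module k V] :
    Subalgebra k (V → k) :=
  Algebra.adjoin k (Set.range fun φ : Module.Dual k V => (φ : V → k))

/-- Zariski open subsets of a (finite-dimensional) vector space: complements of the common zero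
sets of families of polynomial functions. -/
def IsZariskiOpen (k : Type u) {V : Type u} [Field k] [AddCommGroup V] [Module k V]
    (U : Set V) : Prop :=
  ∃ S : Set (V → k), S ⊆ vectorSpacePolynomialFunctions k V ∧ U = {v | ∀ f ∈ S, f v = 0}ᶜ

/-! ### Lengths of quotients by ideals. -/

section Colength

variable {R : Type u} [CommRing R]

/-! Everything follows for any `x` whose degree-one form is a nonzerodivisor of the associated
graded ring `G`, i.e. `m ^ (n + 1) : x = m ^ n` for all `n` (`HasRegularInitialForm`).

Such `x` are generic. `G` is Cohen–Macaulay of nonzero dimension at its irrelevant ideal, so that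
ideal is not an associated prime. Each of the finitely many associated primes therefore meets degree
one in a proper subspace of `m/m²`. Over an infinite field finitely many hyperplanes do not cover
`m/m²`, and their complement is the open set.

For such `x`, suppose `m ^ (n + 1) ⊆ yR` for a parameter `y`. Comparing colengths of `x m ^ (n + 1)`
and `y m ^ (n + 1)` shows that the Hilbert function does not grow from `n` to `n + 1`.
Multiplication by `x` from degree `n` to `n + 1` of `G` is injective, hence onto, and Nakayama gives
`m ^ (n + 1) = x m ^ n ⊆ xR` (`pow_succ_eq_of_le_span_singleton`). So `x` is a witness.

Finally `e(R) = ℓ(R/xR)`, and `x m ^ n ⊆ m ^ (n + 1)` have colengths `e(R) + ℓ(R/m ^ n)` and `μ(m ^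
n) + ℓ(R/m ^ n)`. They agree exactly when `m ^ n` is Ulrich, so the reduction number is the Ulrich
index. -/

theorem length_quotient_eq_add_of_le {A B : Ideal R} (h : A ≤ B) :
    Module.length R (R ⧸ A) =
      Module.length R (B ⧸ A.submoduleOf B) + Module.length R (R ⧸ B) := by
  refine Module.length_eq_add_of_exact (Submodule.mapQ (A.submoduleOf B) A B.subtype le_rfl)
    (Submodule.factor h) ?_ (Submodule.factor_surjective h) ?_
  · rw [injective_iff_map_eq_zero]
    intro x hx
    obtain ⟨x, rfl⟩ := Submodule.Quotient.mk_surjective _ x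
    exact (Submodule.Quotient.mk_eq_zero _).2 ((Submodule.Quotient.mk_eq_zero A).1 hx)
  · intro x
    obtain ⟨x, rfl⟩ := Submodule.Quotient.mk_surjective _ x
    constructor
    · intro hx
      have hx' : x ∈ B := by
        rw [← Submodule.Quotient.mk_eq_zero]
        simpa using hx
      exact ⟨Submodule.Quotient.mk ⟨x, hx'⟩, rfl⟩
    · rintro ⟨y, hy⟩
      obtain ⟨y, rfl⟩ := Submodule.Quotient.mk_surjective _ y
      rw [← hy]
      exact (Submodule.Quotient.mk_eq_zero B).2 y.2

theorem length_quotient_anti {A B : Ideal R} (h : A ≤ B) :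
    Module.length R (R ⧸ B) ≤ Module.length R (R ⧸ A) :=
  Module.length_le_of_surjective _ (Submodule.factor_surjective h)

theorem eq_of_le_of_length_quotient_le {A B : Ideal R} (h : A ≤ B)
    (hl : Module.length R (R ⧸ A) ≤ Module.length R (R ⧸ B))
    (hf : Module.length R (R ⧸ B) ≠ ⊤) : A = B := by
  rw [length_quotient_eq_add_of_le h] at hl
  have h0 : Module.length R (B ⧸ A.submoduleOf B) = 0 := by
    by_contra h0
    have := Order.one_le_iff_ne_zero.2 h0
    have h1 : 1 + Module.length R (R ⧸ B) ≤ Module.length R (R ⧸ B) :=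
      (add_le_add_left this _).trans hl
    rw [add_comm, ENat.add_one_le_iff hf] at h1
    exact lt_irrefl _ h1
  rw [Module.length_eq_zero_iff, Submodule.Quotient.subsingleton_iff] at h0
  exact le_antisymm h (Submodule.submoduleOf_eq_top.1 h0)

/-- Second isomorphism theorem: `A/(A ⊓ B) ≅ (A ⊔ B)/B`. The additive form avoids subtraction in
`ℕ∞`. -/
theorem length_quotient_inf_add_sup (A B : Ideal R) :
    Module.length R (R ⧸ A ⊓ B) + Module.length R (R ⧸ A ⊔ B) =
      Module.length R (R ⧸ A) + Module.length R (R ⧸ B) := by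
  rw [length_quotient_eq_add_of_le (inf_le_left : A ⊓ B ≤ A),
    length_quotient_eq_add_of_le (le_sup_right : B ≤ A ⊔ B)]
  have e := (LinearMap.quotientInfEquivSupQuotient A B).length_eq
  have e' : Module.length R (A ⧸ (A ⊓ B).submoduleOf A) =
    Module.length R (↥(A ⊔ B) ⧸ B.submoduleOf (A ⊔ B)) := e
  rw [e']
  ring

/-- Multiplication by `y` gives the exact sequence `0 → R/I → R/yI → R/yR → 0`. -/
theorem length_quotient_span_singleton_mul {y : R} (hy : IsSMulRegular R y) (I : Ideal R) :
    Module.length R (R ⧸ Ideal.span {y} * I) =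
      Module.length R (R ⧸ Ideal.span {y}) + Module.length R (R ⧸ I) := by
  rw [add_comm]
  have hle : I ≤ Submodule.comap (LinearMap.lsmul R R y) (Ideal.span {y} * I) := fun a ha ↦
    Ideal.mul_mem_mul (Ideal.mem_span_singleton_self y) ha
  refine Module.length_eq_add_of_exact (Submodule.mapQ I _ (LinearMap.lsmul R R y) hle)
    (Submodule.factor Ideal.mul_le_left) ?_ (Submodule.factor_surjective _) ?_
  · rw [injective_iff_map_eq_zero]
    intro x hx
    obtain ⟨x, rfl⟩ := Submodule.Quotient.mk_surjective _ x
    obtain ⟨z, hz, hzx⟩ := Ideal.mem_span_singleton_mul.1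
      ((Submodule.Quotient.mk_eq_zero (Ideal.span {y} * I)).1 hx)
    exact (Submodule.Quotient.mk_eq_zero _).2 (hy hzx ▸ hz)
  · intro x
    obtain ⟨x, rfl⟩ := Submodule.Quotient.mk_surjective _ x
    constructor
    · intro hx
      have hx' : x ∈ Ideal.span {y} := by
        rw [← Submodule.Quotient.mk_eq_zero]
        simpa using hx
      obtain ⟨z, rfl⟩ := Ideal.mem_span_singleton.1 hx'
      exact ⟨Submodule.Quotient.mk z, rfl⟩
    · rintro ⟨z, hz⟩
      obtain ⟨z, rfl⟩ := Submodule.Quotient.mk_surjective _ z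
      rw [← hz]
      exact (Submodule.Quotient.mk_eq_zero _).2
        (Ideal.mul_mem_right z _ (Ideal.mem_span_singleton_self y))

end Colength

/-! ### Number of generators as a difference of colengths. -/

section Local

variable {R : Type u} [CommRing R] [IsLocalRing R] [IsNoetherianRing R]

theorem length_quotient_maximalIdeal_mul (I : Ideal R) :
    Module.length R (R ⧸ maximalIdeal R * I) =
      Submodule.spanFinrank I + Module.length R (R ⧸ I) := by
  rw [length_quotient_eq_add_of_le Ideal.mul_le_right,
    IsLocalRing.spanFinrank_eq_finrank_quotient I I.fg_of_isNoetherianRing]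
  have h1 : (maximalIdeal R * I).submoduleOf I = maximalIdeal R • (⊤ : Submodule R I) := by
    apply Submodule.map_injective_of_injective I.injective_subtype
    rw [Submodule.map_smul'', Submodule.map_top, Submodule.range_subtype, Submodule.submoduleOf,
      Submodule.map_comap_subtype, inf_eq_right.2 Ideal.mul_le_right, smul_eq_mul]
  rw [h1]
  congr 1
  let : Field (R ⧸ maximalIdeal R) := Ideal.Quotient.field _
  have : IsScalarTower R (R ⧸ maximalIdeal R) (I ⧸ maximalIdeal R • (⊤ : Submodule R I)) :=
    ⟨fun a b c ↦ by
      obtain ⟨b, rfl⟩ := Ideal.Quotient.mk_surjective b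
      obtain ⟨c, rfl⟩ := Submodule.Quotient.mk_surjective _ c
      change Submodule.Quotient.mk ((a * b) • c) = a • Submodule.Quotient.mk (b • c)
      rw [mul_smul]; rfl⟩
  rw [Module.length_eq_of_surjective (R := R ⧸ maximalIdeal R) Ideal.Quotient.mk_surjective]
  have : Module.Finite (R ⧸ maximalIdeal R) (I ⧸ maximalIdeal R • (⊤ : Submodule R I)) :=
    Module.Finite.of_restrictScalars_finite R _ _
  exact Module.length_eq_finrank (R ⧸ maximalIdeal R) _

end Local

/-! ### Regular elements in dimension one. -/

section Dimension

theorem krullDimLE_zero_quotient_span_singleton {R : Type u} [CommRing R]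
    (hdim : ringKrullDim R = 1) {y : R}
    (hy : IsSMulRegular R y) : Ring.KrullDimLE 0 (R ⧸ Ideal.span {y}) := by
  have hy' : y ∈ nonZeroDivisors R :=
    mem_nonZeroDivisors_iff_right.2 fun z hz ↦ hy (by simpa [mul_comm] using hz)
  have h := ringKrullDim_quotient_succ_le_of_nonZeroDivisor hy'
  rw [hdim] at h
  rw [Ring.krullDimLE_iff]
  generalize ringKrullDim (R ⧸ Ideal.span {y}) = d at h ⊢
  induction d with
  | bot => exact bot_le
  | coe d =>
    have h : d + 1 ≤ 1 := by exact_mod_cast h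
    have : d ≤ 0 := (ENat.add_le_add_iff_right ENat.one_ne_top).1 (by simpa using h)
    exact_mod_cast this

theorem length_quotient_span_singleton_ne_top {R : Type u} [CommRing R] [IsNoetherianRing R]
    (hdim : ringKrullDim R = 1) {y : R}
    (hy : IsSMulRegular R y) : Module.length R (R ⧸ Ideal.span {y}) ≠ ⊤ := by
  have := krullDimLE_zero_quotient_span_singleton hdim hy
  have : IsArtinianRing (R ⧸ Ideal.span {y}) :=
    IsNoetherianRing.isArtinianRing_of_krullDimLE_zero
  rw [Module.length_eq_of_surjective (R := R ⧸ Ideal.span {y}) Ideal.Quotient.mk_surjective]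
  exact Module.length_ne_top

variable {R : Type u} [CommRing R] [IsLocalRing R]

theorem isRegular_singleton {y : R} (hy : IsSMulRegular R y) (hym : y ∈ maximalIdeal R) :
    RingTheory.Sequence.IsRegular R [y] := by
  rw [IsLocalRing.isRegular_iff_isWeaklyRegular_of_subset_maximalIdeal (by simpa using hym),
    RingTheory.Sequence.isWeaklyRegular_singleton_iff]
  exact hy

theorem maximalIdeal_le_radical_span_singleton (hdim : ringKrullDim R = 1) {y : R}
    (hy : IsSMulRegular R y) :
    maximalIdeal R ≤ (Ideal.span {y}).radical := by
  have := krullDimLE_zero_quotient_span_singleton hdim hy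
  intro a ha
  rw [Ideal.radical_eq_sInf, Ideal.mem_sInf]
  rintro p ⟨hp, hpp⟩
  have hmap := Ideal.map_isPrime_of_surjective (f := Ideal.Quotient.mk (Ideal.span {y}))
    Ideal.Quotient.mk_surjective (I := p) (by simpa using hp)
  have hmax := Ring.krullDimLE_zero_iff.1 this _ hmap
  have hmax' := Ideal.comap_isMaximal_of_surjective (Ideal.Quotient.mk (Ideal.span {y}))
    Ideal.Quotient.mk_surjective  (K := p.map (Ideal.Quotient.mk (Ideal.span {y})))
  rw [Ideal.comap_map_of_surjective _ Ideal.Quotient.mk_surjective, ← RingHom.ker_eq_comap_bot,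
    Ideal.mk_ker, sup_eq_left.2 hp] at hmax'
  rwa [eq_maximalIdeal hmax']

variable [IsNoetherianRing R]

theorem exists_pow_le_span_singleton (hdim : ringKrullDim R = 1) {y : R}
    (hy : IsSMulRegular R y) :
    ∃ n, maximalIdeal R ^ n ≤ Ideal.span {y} :=
  Ideal.exists_pow_le_of_le_radical_of_fg (maximalIdeal_le_radical_span_singleton hdim hy)
    (maximalIdeal R).fg_of_isNoetherianRing

theorem length_quotient_maximalIdeal_pow_ne_top (n : ℕ) :
    Module.length R (R ⧸ maximalIdeal R ^ n) ≠ ⊤ := by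
  induction n with
  | zero =>
    have : Subsingleton (R ⧸ maximalIdeal R ^ 0) :=
      Ideal.Quotient.subsingleton_iff.2 (by simp)
    simp [Module.length_eq_zero]
  | succ n ih =>
    rw [pow_succ', length_quotient_maximalIdeal_mul]
    exact WithTop.add_ne_top.2 ⟨ENat.natCast_ne_top _, ih⟩

end Dimension

/-- The initial form of `x` is a nonzerodivisor of degree one in the associated graded ring,
expressed through the colon ideals `m ^ (n + 1) : x = m ^ n`. -/
structure HasRegularInitialForm {R : Type u} [CommRing R] [IsLocalRing R] (x : R) : Prop where
  mem : x ∈ maximalIdeal R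
  colon : ∀ n c, x * c ∈ maximalIdeal R ^ (n + 1) → c ∈ maximalIdeal R ^ n

/-! ### Consequences of a regular initial form in degree one. -/

namespace HasRegularInitialForm

variable {R : Type u} [CommRing R] [IsLocalRing R] {x : R}

theorem pow_succ_eq (hx : HasRegularInitialForm x) {n : ℕ}
    (h : maximalIdeal R ^ (n + 1) ≤ Ideal.span {x}) :
    maximalIdeal R ^ (n + 1) = Ideal.span {x} * maximalIdeal R ^ n := by
  refine le_antisymm (fun z hz ↦ ?_) ?_
  · obtain ⟨c, rfl⟩ := Ideal.mem_span_singleton.1 (h hz)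
    exact Ideal.mul_mem_mul (Ideal.mem_span_singleton_self x) (hx.colon n c hz)
  · rw [pow_succ']
    exact Ideal.mul_mono_left ((Ideal.span_singleton_le_iff_mem _).2 hx.mem)

theorem span_singleton_mul_pow_le (hx : HasRegularInitialForm x) (n : ℕ) :
    Ideal.span {x} * maximalIdeal R ^ n ≤ maximalIdeal R ^ (n + 1) := by
  rw [pow_succ']
  exact Ideal.mul_mono_left ((Ideal.span_singleton_le_iff_mem _).2 hx.mem)

variable [IsNoetherianRing R]

/-- If `x * c = 0`, the colon condition puts `c` in every power of `m`; Krull's intersection theorem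
gives `c = 0`. -/
theorem isSMulRegular (hx : HasRegularInitialForm x) : IsSMulRegular R x := by
  rw [isSMulRegular_iff_right_eq_zero_of_smul]
  intro c hc
  have h : c ∈ ⨅ n : ℕ, maximalIdeal R ^ n := by
    rw [Ideal.mem_iInf]
    exact fun n ↦ hx.colon n c (by rw [← smul_eq_mul, hc]; exact zero_mem _)
  rwa [Ideal.iInf_pow_eq_bot_of_isLocalRing _ (maximalIdeal.isMaximal R).ne_top] at h

/-- If `m ^ (n + 1)` lies in some ideal generated by a parameter `y`, then it lies in `xR`: the
Hilbert function does not grow from degree `n` to degree `n + 1`. -/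
theorem pow_succ_eq_of_le_span_singleton (hx : HasRegularInitialForm x)
    (hdim : ringKrullDim R = 1) {y : R} (hy : IsSMulRegular R y) (hym : y ∈ maximalIdeal R)
    {n : ℕ} (h : maximalIdeal R ^ (n + 1) ≤ Ideal.span {y}) :
    maximalIdeal R ^ (n + 1) = Ideal.span {x} * maximalIdeal R ^ n := by
  have hxR := hx.isSMulRegular
  have hfy := length_quotient_span_singleton_ne_top hdim hy
  have hfx := length_quotient_span_singleton_ne_top hdim hxR
  have hf := length_quotient_maximalIdeal_pow_ne_top (R := R)
  set m := maximalIdeal R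
  have hym' : Ideal.span {y} * m ^ (n + 1) ≤ m ^ (n + 1 + 1) := by
    rw [pow_succ' m (n + 1)]
    exact Ideal.mul_mono_left ((Ideal.span_singleton_le_iff_mem _).2 hym)
  -- If `xa = yb`, then `a = yc` because `m ^ (n + 1) ⊆ yR`; cancelling `y` gives `b = xc`, and the
  -- colon condition puts `c` in `m ^ n`.
  have hinf : Ideal.span {x} * m ^ (n + 1) ⊓ Ideal.span {y} * m ^ (n + 1) ≤
      Ideal.span {x} * (Ideal.span {y} * m ^ n) := by
    rintro z ⟨hz1, hz2⟩
    obtain ⟨a, ha, rfl⟩ := Ideal.mem_span_singleton_mul.1 hz1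
    obtain ⟨b, hb, hab⟩ := Ideal.mem_span_singleton_mul.1 hz2
    obtain ⟨c, rfl⟩ := Ideal.mem_span_singleton.1 (h ha)
    have hbc : b = x * c := hy (by simp only [smul_eq_mul]; rw [hab]; ring)
    exact Ideal.mul_mem_mul (Ideal.mem_span_singleton_self x)
      (Ideal.mul_mem_mul (Ideal.mem_span_singleton_self y) (hx.colon n c (hbc ▸ hb)))
  -- This says `ℓ(m ^ (n + 1)/m ^ (n + 2)) ≤ ℓ(m ^ n/m ^ (n + 1))`; the lengths of `R/xR` and `R/yR`
  -- cancel.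
  have hconc : Module.length R (R ⧸ m ^ (n + 1 + 1)) + Module.length R (R ⧸ m ^ n) ≤
      Module.length R (R ⧸ m ^ (n + 1)) + Module.length R (R ⧸ m ^ (n + 1)) := by
    have h1 := length_quotient_inf_add_sup (Ideal.span {x} * m ^ (n + 1))
      (Ideal.span {y} * m ^ (n + 1))
    have h2 := length_quotient_anti hinf
    have hsup : Ideal.span {x} * m ^ (n + 1) ⊔ Ideal.span {y} * m ^ (n + 1) ≤ m ^ (n + 1 + 1) :=
      sup_le (hx.span_singleton_mul_pow_le (n + 1)) hym'
    have h3 := length_quotient_anti hsup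
    simp only [length_quotient_span_singleton_mul hxR, length_quotient_span_singleton_mul hy]
      at h1 h2
    have hg := add_le_add h2 h3
    rw [h1] at hg
    lift Module.length R (R ⧸ Ideal.span {x}) to ℕ using hfx with a
    lift Module.length R (R ⧸ Ideal.span {y}) to ℕ using hfy with b
    have h0 := hf n
    have h1 := hf (n + 1)
    have h2 := hf (n + 1 + 1)
    lift Module.length R (R ⧸ m ^ n) to ℕ using h0 with p
    lift Module.length R (R ⧸ m ^ (n + 1)) to ℕ using h1 with q
    lift Module.length R (R ⧸ m ^ (n + 1 + 1)) to ℕ using h2 with r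
    norm_cast at hg ⊢
    have hg' : a + (b + p) + r ≤ a + q + (b + q) := by exact_mod_cast hg
    omega
  -- Multiplication by `x` on graded pieces is injective and the target is no longer than the
  -- source, so it is onto.
  have hsup : Ideal.span {x} * m ^ n ⊔ m ^ (n + 1 + 1) = m ^ (n + 1) := by
    have hle : Ideal.span {x} * m ^ n ⊔ m ^ (n + 1 + 1) ≤ m ^ (n + 1) :=
      sup_le (hx.span_singleton_mul_pow_le n) (Ideal.pow_le_pow_right (by omega))
    refine eq_of_le_of_length_quotient_le hle ?_ (hf (n + 1))
    have h1 := length_quotient_inf_add_sup (Ideal.span {x} * m ^ n) (m ^ (n + 1 + 1))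
    have hle' : Ideal.span {x} * m ^ (n + 1) ≤ Ideal.span {x} * m ^ n ⊓ m ^ (n + 1 + 1) :=
      le_inf (Ideal.mul_mono_right (Ideal.pow_le_pow_right (by omega)))
        (hx.span_singleton_mul_pow_le (n + 1))
    have hinf' : Ideal.span {x} * m ^ n ⊓ m ^ (n + 1 + 1) = Ideal.span {x} * m ^ (n + 1) := by
      refine le_antisymm ?_ hle'
      rintro z ⟨hz1, hz2⟩
      obtain ⟨a, ha, rfl⟩ := Ideal.mem_span_singleton_mul.1 hz1
      exact Ideal.mul_mem_mul (Ideal.mem_span_singleton_self x) (hx.colon (n + 1) a hz2)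
    rw [hinf'] at h1
    simp only [length_quotient_span_singleton_mul hxR] at h1
    have hs : Module.length R (R ⧸ Ideal.span {x} * m ^ n ⊔ m ^ (n + 1 + 1)) ≠ ⊤ := by
      refine ne_top_of_le_ne_top ?_ (length_quotient_anti le_sup_right)
      exact hf (n + 1 + 1)
    lift Module.length R (R ⧸ Ideal.span {x}) to ℕ using hfx with a
    lift Module.length R (R ⧸ Ideal.span {x} * m ^ n ⊔ m ^ (n + 1 + 1)) to ℕ using hs with s
    have h0 := hf n
    have h1' := hf (n + 1)
    have h2 := hf (n + 1 + 1)
    lift Module.length R (R ⧸ m ^ n) to ℕ using h0 with p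
    lift Module.length R (R ⧸ m ^ (n + 1)) to ℕ using h1' with q
    lift Module.length R (R ⧸ m ^ (n + 1 + 1)) to ℕ using h2 with r
    norm_cast at h1 hconc ⊢
    have h1' : a + q + s = a + p + r := by exact_mod_cast h1
    omega
  refine le_antisymm ?_ (hx.span_singleton_mul_pow_le n)
  refine Submodule.le_of_le_smul_of_le_jacobson_bot
    (m ^ (n + 1)).fg_of_isNoetherianRing (IsLocalRing.maximalIdeal_le_jacobson ⊥) ?_
  rw [smul_eq_mul, ← pow_succ', hsup]

theorem isGllWitness (hx : HasRegularInitialForm x) (hdim : ringKrullDim R = 1) :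
    IsGllWitness [x] where
  length_eq := by simp [hdim]
  mem := by simpa using hx.mem
  regular := isRegular_singleton hx.isSMulRegular hx.mem
  pow_le := by
    have hsop : IsSystemOfParameters [x] := by
      refine ⟨by simp [hdim], ?_⟩
      rw [Ideal.ofList_singleton]
      refine le_antisymm ?_ (maximalIdeal_le_radical_span_singleton hdim hx.isSMulRegular)
      rw [(maximalIdeal.isMaximal R).isPrime.radical_le_iff, Ideal.span_singleton_le_iff_mem]
      exact hx.mem
    obtain ⟨N, hN⟩ := exists_pow_le_span_singleton hdim hx.isSMulRegular
    have hne : {n | 0 < n ∧ ∃ rs : List R, IsSystemOfParameters rs ∧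
        maximalIdeal R ^ n ≤ Ideal.ofList rs}.Nonempty :=
      ⟨N + 1, N.succ_pos, [x], hsop, by
        rw [Ideal.ofList_singleton]
        exact (Ideal.pow_le_pow_right N.le_succ).trans hN⟩
    obtain ⟨hpos, rs, hrs, hle⟩ := Nat.sInf_mem hne
    change 0 < gll R at hpos
    change maximalIdeal R ^ gll R ≤ Ideal.ofList rs at hle
    have hlen : rs.length = 1 := by
      have := hrs.length_eq
      rw [hdim] at this
      exact_mod_cast this
    obtain ⟨y, rfl⟩ := List.length_eq_one_iff.1 hlen
    have hrad := hrs.radical_eq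
    rw [Ideal.ofList_singleton] at hrad hle ⊢
    have hym : y ∈ maximalIdeal R :=
      hrad ▸ Ideal.le_radical (Ideal.mem_span_singleton_self y)
    -- Some power of the regular element `x` is a multiple of `y`.
    have hy : IsSMulRegular R y := by
      have hxy : x ∈ (Ideal.span {y}).radical := hrad ▸ hx.mem
      obtain ⟨k, hk⟩ := hxy
      obtain ⟨c, hc⟩ := Ideal.mem_span_singleton.1 hk
      have := hx.isSMulRegular.pow k
      rw [hc, mul_comm] at this
      exact IsSMulRegular.of_mul (R := R) (a := c) this
    -- The positivity built into `gll` allows writing it as `n + 1`.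
    obtain ⟨n, hn⟩ := Nat.exists_eq_succ_of_ne_zero hpos.ne'
    rw [hn] at hle ⊢
    rw [hx.pow_succ_eq_of_le_span_singleton hdim hy hym hle]
    exact Ideal.mul_le_left

theorem exists_pow_succ_eq (hx : HasRegularInitialForm x) (hdim : ringKrullDim R = 1) :
    ∃ n, maximalIdeal R ^ (n + 1) = Ideal.span {x} * maximalIdeal R ^ n := by
  obtain ⟨N, hN⟩ := exists_pow_le_span_singleton hdim hx.isSMulRegular
  exact ⟨N, hx.pow_succ_eq ((Ideal.pow_le_pow_right N.le_succ).trans hN)⟩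

theorem pow_succ_eq_iff (hx : HasRegularInitialForm x) (hdim : ringKrullDim R = 1) (n : ℕ) :
    Ideal.span {x} * maximalIdeal R ^ n = maximalIdeal R ^ (n + 1) ↔
      Submodule.spanFinrank (maximalIdeal R ^ n) =
        (Module.length R (R ⧸ Ideal.span {x})).toNat := by
  have hfx := length_quotient_span_singleton_ne_top hdim hx.isSMulRegular
  have h1 := length_quotient_span_singleton_mul hx.isSMulRegular (maximalIdeal R ^ n)
  have h2 := length_quotient_maximalIdeal_mul (maximalIdeal R ^ n)
  have hf := length_quotient_maximalIdeal_pow_ne_top (R := R) n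
  rw [← pow_succ'] at h2
  rw [← ENat.natCast_inj, ENat.natCast_toNat hfx]
  constructor
  · intro h
    rw [h, h2] at h1
    exact WithTop.add_right_cancel hf h1
  · intro h
    rw [h, ← h1] at h2
    exact eq_of_le_of_length_quotient_le (hx.span_singleton_mul_pow_le n) h2.ge
      (length_quotient_maximalIdeal_pow_ne_top _)

theorem tendsto_length (hx : HasRegularInitialForm x) (hdim : ringKrullDim R = 1) :
    Filter.Tendsto (fun n : ℕ ↦
      ((Module.length R (R ⧸ maximalIdeal R ^ n)).toNat : ℝ) / (n : ℝ)) Filter.atTop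
      (nhds ((Module.length R (R ⧸ Ideal.span {x})).toNat : ℝ)) := by
  obtain ⟨r, hr⟩ := hx.exists_pow_succ_eq hdim
  have hfx := length_quotient_span_singleton_ne_top hdim hx.isSMulRegular
  set e := (Module.length R (R ⧸ Ideal.span {x})).toNat with he
  set c := (Module.length R (R ⧸ maximalIdeal R ^ r)).toNat with hc
  have hrec (k : ℕ) :
      (Module.length R (R ⧸ maximalIdeal R ^ (r + k))).toNat = c + k * e := by
    induction k with
    | zero => simp [hc]
    | succ k ih =>
      have : maximalIdeal R ^ (r + (k + 1)) = Ideal.span {x} * maximalIdeal R ^ (r + k) := by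
        rw [show r + (k + 1) = (r + 1) + k by ring, pow_add, hr, mul_assoc, ← pow_add]
      rw [this, length_quotient_span_singleton_mul hx.isSMulRegular,
        ENat.toNat_add hfx (length_quotient_maximalIdeal_pow_ne_top _), ih]
      ring
  -- For `n ≥ r` the colength is `c + (n - r) * e`; this is its quotient by `n`.
  have hlim : Filter.Tendsto (fun n : ℕ ↦ (e : ℝ) + ((c : ℝ) - r * e) / n) Filter.atTop
      (nhds ((e : ℝ) + 0)) :=
    tendsto_const_nhds.add (tendsto_const_div_atTop_nhds_zero_nat _)
  rw [add_zero] at hlim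
  refine hlim.congr' ?_
  filter_upwards [Filter.eventually_ge_atTop (r + 1)] with n hn
  obtain ⟨k, rfl⟩ := Nat.exists_eq_add_of_le (show r ≤ n by omega)
  have hpos : ((r + k : ℕ) : ℝ) ≠ 0 := by
    norm_cast
    omega
  rw [hrec]
  field_simp
  push_cast
  ring

theorem hilbertSamuelMultiplicity_eq (hx : HasRegularInitialForm x)
    (hdim : ringKrullDim R = 1) :
    hilbertSamuelMultiplicity R = (Module.length R (R ⧸ Ideal.span {x})).toNat := by
  have hd : krullDimNat R = 1 := by
    rw [krullDimNat, hdim]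
    rfl
  rw [hilbertSamuelMultiplicity, hd]
  simpa using (hx.tendsto_length hdim).limUnder_eq

theorem reductionNumber_eq (hx : HasRegularInitialForm x) (hdim : ringKrullDim R = 1) :
    reductionNumber (Ideal.span {x}) (maximalIdeal R) = ulr R := by
  rw [reductionNumber, ulr]
  -- The two sets of exponents coincide, not merely their infima.
  congr 1
  ext n
  refine (hx.pow_succ_eq_iff hdim n).trans ⟨fun h ↦ ⟨fun z hz ↦ ⟨n, Ideal.pow_mem_pow hz n⟩, ?_⟩,
    fun h ↦ ?_⟩
  · rw [hx.hilbertSamuelMultiplicity_eq hdim, h]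
  · have := h.generators_eq
    rw [hx.hilbertSamuelMultiplicity_eq hdim] at this
    exact_mod_cast this

end HasRegularInitialForm

/-! ### Homogeneous elements of the associated graded ring. -/

open Polynomial

/-- A type synonym of the associated graded ring, so that its ring structure is found directly. -/
def AssociatedGraded {R : Type u} [CommRing R] (I : Ideal R) : Type u := AssocGradedRing I

noncomputable instance {R : Type u} [CommRing R] (I : Ideal R) : CommRing (AssociatedGraded I) :=
  inferInstanceAs (CommRing (AssocGradedRing I))

instance {R : Type u} [CommRing R] [IsNoetherianRing R] (I : Ideal R) :
    IsNoetherianRing (AssociatedGraded I) :=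
  inferInstanceAs (IsNoetherianRing (AssocGradedRing I))

namespace AssociatedGraded

section Ideal

variable {R : Type u} [CommRing R] {I : Ideal R}

variable (I) in
/-- The quotient map from the Rees algebra. -/
noncomputable def mk : reesAlgebra I →+* AssociatedGraded I :=
  Ideal.Quotient.mk (I.map (algebraMap R (reesAlgebra I)))

variable (I) in
theorem mk_surjective : Function.Surjective (mk I) :=
  Ideal.Quotient.mk_surjective

theorem mk_eq_zero_iff {f : reesAlgebra I} :
    mk I f = 0 ↔ f ∈ I.map (algebraMap R (reesAlgebra I)) :=
  Ideal.Quotient.eq_zero_iff_mem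

/-- The class in degree `n` of an element of `I ^ n`. -/
noncomputable def homogeneous (n : ℕ) {c : R} (hc : c ∈ I ^ n) : AssociatedGraded I :=
  mk _ ⟨monomial n c, reesAlgebra.monomial_mem.2 hc⟩

/-- With `monomial_mem_map`, this identifies the extended ideal with `⨁ I ^ (n + 1) t ^ n`, so that
vanishing in the quotient can be tested on coefficients. -/
theorem coeff_mem_of_mem_map {f : reesAlgebra I}
    (hf : f ∈ I.map (algebraMap R (reesAlgebra I))) (n : ℕ) :
    (f : R[X]).coeff n ∈ I ^ (n + 1) := by
  induction hf using Submodule.span_induction generalizing n with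
  | mem f hf =>
    obtain ⟨a, ha, rfl⟩ := hf
    change (C a : R[X]).coeff n ∈ I ^ (n + 1)
    rw [coeff_C]
    split_ifs with h
    · simpa [h] using ha
    · exact zero_mem _
  | zero => simp
  | add f g _ _ hf hg => simpa using add_mem (hf n) (hg n)
  | smul g f _ hf =>
    rw [smul_eq_mul, MulMemClass.coe_mul, coeff_mul]
    refine Ideal.sum_mem _ fun ij hij ↦ ?_
    rw [← Finset.HasAntidiagonal.mem_antidiagonal.1 hij, add_assoc, pow_add]
    exact Ideal.mul_mem_mul (g.2 _) (hf _)

theorem monomial_mem_map {n : ℕ} {c : R} (hc : c ∈ I ^ n) (hc' : c ∈ I ^ (n + 1)) :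
    (⟨monomial n c, reesAlgebra.monomial_mem.2 hc⟩ : reesAlgebra I) ∈
      I.map (algebraMap R (reesAlgebra I)) := by
  rw [pow_succ'] at hc'
  induction hc' using Submodule.mul_induction_on' with
  | mem_mul_mem a ha b hb =>
    have : (⟨monomial n (a * b), reesAlgebra.monomial_mem.2 hc⟩ : reesAlgebra I) =
        algebraMap R (reesAlgebra I) a * ⟨monomial n b, reesAlgebra.monomial_mem.2 hb⟩ := by
      apply Subtype.ext
      change monomial n (a * b) = C a * monomial n b
      rw [C_mul_monomial]
    rw [this]
    exact Ideal.mul_mem_right _ _ (Ideal.mem_map_of_mem _ ha)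
  | add a ha b hb iha ihb =>
    have ha' : a ∈ I ^ n := Ideal.mul_le_right ha
    have hb' : b ∈ I ^ n := Ideal.mul_le_right hb
    have : (⟨monomial n (a + b), reesAlgebra.monomial_mem.2 hc⟩ : reesAlgebra I) =
        ⟨monomial n a, reesAlgebra.monomial_mem.2 ha'⟩ +
          ⟨monomial n b, reesAlgebra.monomial_mem.2 hb'⟩ :=
      Subtype.ext (map_add (monomial n) a b)
    rw [this]
    exact add_mem (iha ha') (ihb hb')

theorem homogeneous_eq_zero_iff {n : ℕ} {c : R} (hc : c ∈ I ^ n) :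
    homogeneous n hc = 0 ↔ c ∈ I ^ (n + 1) := by
  rw [homogeneous, mk_eq_zero_iff]
  refine ⟨fun h ↦ ?_, monomial_mem_map hc⟩
  simpa using coeff_mem_of_mem_map h n

theorem homogeneous_mul {i j n : ℕ} {a b : R} (ha : a ∈ I ^ i) (hb : b ∈ I ^ j)
    (hn : i + j = n) (hab : a * b ∈ I ^ n) :
    homogeneous i ha * homogeneous j hb = homogeneous n hab := by
  subst hn
  rw [homogeneous, homogeneous, ← map_mul]
  congr 1
  exact Subtype.ext (monomial_mul_monomial i j a b)

theorem homogeneous_add {n : ℕ} {a b : R} (ha : a ∈ I ^ n) (hb : b ∈ I ^ n) :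
    homogeneous n (add_mem ha hb) = homogeneous n ha + homogeneous n hb := by
  rw [homogeneous, homogeneous, homogeneous, ← map_add]
  congr 1
  exact Subtype.ext (map_add (monomial n) a b)

/-- The class in degree one of an element of `I`. -/
noncomputable def degreeOne (x : I) : AssociatedGraded I :=
  homogeneous 1 (by rw [pow_one]; exact x.2)

theorem degreeOne_add (x y : I) : degreeOne (x + y) = degreeOne x + degreeOne y :=
  homogeneous_add _ _

theorem degreeOne_smul (a : R) (x : I) :
    degreeOne (a • x) = mk I (algebraMap R _ a) * degreeOne x := by
  rw [degreeOne, degreeOne, homogeneous, homogeneous, ← map_mul]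
  congr 1
  exact Subtype.ext (C_mul_monomial (R := R)).symm

theorem degreeOne_eq_zero_iff {x : I} : degreeOne x = 0 ↔ (x : R) ∈ I ^ 2 :=
  homogeneous_eq_zero_iff _

theorem degreeOne_mul_homogeneous (x : I) {n : ℕ} {c : R} (hc : c ∈ I ^ n)
    (hxc : (x : R) * c ∈ I ^ (n + 1)) :
    degreeOne x * homogeneous n hc = homogeneous (n + 1) hxc :=
  homogeneous_mul _ hc (add_comm 1 n) hxc

/-- The class of an element of degree `n` lies in the `n`-th power of an ideal containing
the elements of degree one. -/
theorem homogeneous_mem_pow {M : Ideal (AssociatedGraded I)} (hM : ∀ x : I, degreeOne x ∈ M)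
    {n : ℕ} {c : R} (hc : c ∈ I ^ n) : homogeneous n hc ∈ M ^ n := by
  induction n generalizing c with
  | zero => rw [pow_zero, Ideal.one_eq_top]; trivial
  | succ n ih =>
    have hc' := hc
    rw [pow_succ'] at hc'
    induction hc' using Submodule.mul_induction_on' with
    | mem_mul_mem a ha b hb =>
      rw [← degreeOne_mul_homogeneous ⟨a, ha⟩ hb, pow_succ']
      exact Ideal.mul_mem_mul (hM ⟨a, ha⟩) (ih hb)
    | add a ha b hb iha ihb =>
      rw [← pow_succ'] at ha hb
      rw [homogeneous_add ha hb]
      exact add_mem (iha ha) (ihb hb)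

end Ideal

/-! ### The irrelevant maximal ideal and depth there. -/

section Local

variable {R : Type u} [CommRing R] [IsLocalRing R]

variable (R) in
/-- The projection of the associated graded ring to the residue field. -/
noncomputable def toResidueField : AssociatedGraded (maximalIdeal R) →+* ResidueField R :=
  Ideal.Quotient.lift _
    ((residue R).comp (constantCoeff.comp (reesAlgebra (maximalIdeal R)).val.toRingHom))
    fun f hf ↦ by
      have := coeff_mem_of_mem_map hf 0
      rw [zero_add, pow_one] at this
      exact (residue_eq_zero_iff _).2 this

theorem toResidueField_mk (f : reesAlgebra (maximalIdeal R)) :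
    toResidueField R (mk _ f) = residue R ((f : R[X]).coeff 0) :=
  rfl

theorem toResidueField_surjective : Function.Surjective (toResidueField R) := fun a ↦ by
  obtain ⟨a, rfl⟩ := residue_surjective a
  exact ⟨mk _ (algebraMap R _ a), by
    rw [toResidueField_mk]
    change residue R ((C a : R[X]).coeff 0) = _
    rw [coeff_C_zero]⟩

variable (R) in
/-- The irrelevant maximal ideal of the associated graded ring. -/
noncomputable abbrev irrelevant : Ideal (AssociatedGraded (maximalIdeal R)) :=
  RingHom.ker (toResidueField R)

instance : (irrelevant R).IsMaximal :=
  RingHom.ker_isMaximal_of_surjective _ toResidueField_surjective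

theorem degreeOne_mem_irrelevant (x : maximalIdeal R) :
    degreeOne x ∈ irrelevant R := by
  rw [RingHom.mem_ker]
  rw [degreeOne, homogeneous, toResidueField_mk]
  simp

/-- The Rees algebra is generated over `R` in degree one, so `f` minus its constant term maps into
`P`; on the irrelevant ideal that constant term lies in `m` and dies. -/
theorem irrelevant_le {P : Ideal (AssociatedGraded (maximalIdeal R))}
    (hP : ∀ x : maximalIdeal R, degreeOne x ∈ P) : irrelevant R ≤ P := by
  let m := maximalIdeal R
  have key (f : R[X]) (hf : f ∈ reesAlgebra m) :
      mk _ (⟨f, hf⟩ - algebraMap R (reesAlgebra m) (f.coeff 0)) ∈ P := by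
    have hf' := hf
    rw [← adjoin_monomial_eq_reesAlgebra] at hf'
    induction hf' using Algebra.adjoin_induction with
    | mem f hf' =>
      obtain ⟨x, hx, rfl⟩ := hf'
      convert hP ⟨x, hx⟩ using 1
      rw [degreeOne, homogeneous]
      congr 1
      simp
    | algebraMap r =>
      convert P.zero_mem
      rw [mk_eq_zero_iff]
      convert Ideal.zero_mem _
      rw [sub_eq_zero]
      apply Subtype.ext
      change C r = C ((C r : R[X]).coeff 0)
      rw [coeff_C_zero]
    | add f g hf' hg' ihf ihg =>
      rw [adjoin_monomial_eq_reesAlgebra] at hf' hg'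
      convert add_mem (ihf hf') (ihg hg') using 1
      rw [← map_add]
      congr 1
      rw [coeff_add, map_add]
      have : (⟨f + g, hf⟩ : reesAlgebra m) = ⟨f, hf'⟩ + ⟨g, hg'⟩ := rfl
      rw [this]
      ring
    | mul f g hf' hg' ihf ihg =>
      rw [adjoin_monomial_eq_reesAlgebra] at hf' hg'
      -- Uses `fg - f₀g₀ = f(g - g₀) + g₀(f - f₀)`.
      convert add_mem (P.mul_mem_left (mk _ ⟨f, hf'⟩) (ihg hg'))
        (P.mul_mem_left (mk _ (algebraMap R _ (g.coeff 0))) (ihf hf')) using 1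
      rw [← map_mul, ← map_mul, ← map_add]
      congr 1
      rw [mul_coeff_zero, map_mul]
      have : (⟨f * g, hf⟩ : reesAlgebra m) = ⟨f, hf'⟩ * ⟨g, hg'⟩ := rfl
      rw [this]
      ring
  intro f hf
  obtain ⟨f, rfl⟩ := mk_surjective _ f
  rw [RingHom.mem_ker, toResidueField_mk, residue_eq_zero_iff] at hf
  have h := key f f.2
  rw [map_sub] at h
  have h0 : mk (maximalIdeal R) (algebraMap R (reesAlgebra m) ((f : R[X]).coeff 0)) = 0 :=
    mk_eq_zero_iff.2 (Ideal.mem_map_of_mem _ hf)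
  rw [h0, sub_zero] at h
  exact h

/-- The constant coefficient of a lift of `s` is a unit, and the degree `n` part of the product is
that unit times `c`. -/
theorem mem_pow_succ_of_mul_homogeneous_eq_zero {s : AssociatedGraded (maximalIdeal R)}
    (hs : s ∉ irrelevant R) {n : ℕ} {c : R} (hc : c ∈ maximalIdeal R ^ n)
    (h : s * homogeneous n hc = 0) : c ∈ maximalIdeal R ^ (n + 1) := by
  obtain ⟨f, rfl⟩ := mk_surjective _ s
  rw [RingHom.mem_ker, toResidueField_mk, residue_eq_zero_iff, mem_maximalIdeal, mem_nonunits_iff,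
    not_not] at hs
  rw [homogeneous, ← map_mul, mk_eq_zero_iff] at h
  have := coeff_mem_of_mem_map h n
  have hcoeff : ((f : R[X]) * monomial n c).coeff n = (f : R[X]).coeff 0 * c := by
    simpa using coeff_mul_monomial (f : R[X]) n 0 c
  change ((f : R[X]) * monomial n c).coeff n ∈ _ at this
  rw [hcoeff] at this
  exact (Ideal.unit_mul_mem_iff_mem _ hs).1 this

theorem hasRegularInitialForm_of_mem_nonZeroDivisors {x : maximalIdeal R}
    (hx : degreeOne x ∈ nonZeroDivisors (AssociatedGraded (maximalIdeal R))) :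
    HasRegularInitialForm (x : R) where
  mem := x.2
  colon n := by
    induction n with
    | zero => simp
    | succ n ih =>
      intro c hc
      have hcn := ih c (Ideal.pow_le_pow_right (by omega) hc)
      rw [← homogeneous_eq_zero_iff hcn]
      apply (mem_nonZeroDivisors_iff.1 hx).1
      rw [degreeOne_mul_homogeneous x hcn (by rw [pow_succ']; exact Ideal.mul_mem_mul x.2 hcn),
        homogeneous_eq_zero_iff]
      exact hc

variable [IsNoetherianRing R]

instance : IsNoetherianRing (Localization.AtPrime (irrelevant R)) :=
  IsLocalization.isNoetherianRing (irrelevant R).primeCompl _ inferInstance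

/-- Otherwise the `n`-th power of the local maximal ideal vanishes for some `n`. Classes of elements
of `m ^ n` are then killed by elements outside the irrelevant ideal, so `m ^ n = m ^ (n + 1)`,
whence `m ^ n = 0` and `R` is Artinian. -/
theorem ringKrullDim_localization_irrelevant_ne_zero
    (hdim : ringKrullDim R ≠ 0) :
    ringKrullDim (Localization.AtPrime (irrelevant R)) ≠ 0 := by
  intro h0
  rw [← ringKrullDimZero_iff_ringKrullDim_eq_zero, ← isArtinianRing_iff_krullDimLE_zero,
    isArtinianRing_iff_isNilpotent_maximalIdeal] at h0
  obtain ⟨n, hn⟩ := h0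
  have hle : maximalIdeal R ^ n ≤ maximalIdeal R • maximalIdeal R ^ n := by
    intro c hc
    rw [smul_eq_mul, ← pow_succ']
    have hmem := Ideal.mem_map_of_mem (algebraMap _ (Localization.AtPrime (irrelevant R)))
      (homogeneous_mem_pow degreeOne_mem_irrelevant hc)
    rw [Ideal.map_pow, Localization.AtPrime.map_eq_maximalIdeal, hn, Ideal.zero_eq_bot,
      Ideal.mem_bot, IsLocalization.map_eq_zero_iff (irrelevant R).primeCompl] at hmem
    obtain ⟨s, hs⟩ := hmem
    exact mem_pow_succ_of_mul_homogeneous_eq_zero s.2 hc hs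
  have hbot := Submodule.eq_bot_of_le_smul_of_le_jacobson_bot _ _
    (maximalIdeal R ^ n).fg_of_isNoetherianRing hle (IsLocalRing.maximalIdeal_le_jacobson ⊥)
  apply hdim
  rw [← ringKrullDimZero_iff_ringKrullDim_eq_zero, ← isArtinianRing_iff_krullDimLE_zero,
    isArtinianRing_iff_isNilpotent_maximalIdeal]
  exact ⟨n, hbot⟩

/-- If the irrelevant ideal were the annihilator of `g`, a regular element of the localized maximal
ideal would kill `g/1`. Then `g/1 = 0`, so `g` is killed by something outside its own annihilator.
-/
theorem irrelevant_notMem_associatedPrimes (hdim : ringKrullDim R ≠ 0)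
    (hGr : IsCMRing (AssociatedGraded (maximalIdeal R))) :
    irrelevant R ∉ associatedPrimes (AssociatedGraded (maximalIdeal R))
      (AssociatedGraded (maximalIdeal R)) := by
  intro hass
  rw [AssociatedPrimes.mem_iff, isAssociatedPrime_iff] at hass
  obtain ⟨-, g, hg⟩ := hass
  have hg (a) : a ∈ irrelevant R ↔ a * g = 0 := by
    conv_lhs => rw [hg]
    simp [Submodule.mem_colon_singleton]
  obtain ⟨rs, hlen, hmem, hreg⟩ := (hGr.localization (irrelevant R)).exists_regular
  match rs with
  | [] =>
    exact ringKrullDim_localization_irrelevant_ne_zero hdim (by simpa using hlen.symm)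
  | r :: rs =>
    have hr := ((RingTheory.Sequence.isRegular_cons_iff _ _ _).1 hreg).1
    have hrm := hmem r (by simp)
    obtain ⟨a, s, rfl⟩ := IsLocalization.exists_mk'_eq (irrelevant R).primeCompl r
    rw [IsLocalization.AtPrime.mk'_mem_maximal_iff _ (irrelevant R), hg] at hrm
    have h0 : algebraMap _ (Localization.AtPrime (irrelevant R)) g = 0 := by
      rw [isSMulRegular_iff_right_eq_zero_of_smul] at hr
      apply hr
      rw [smul_eq_mul, mul_comm, IsLocalization.mul_mk'_eq_mk'_of_mul, mul_comm, hrm,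
        IsLocalization.mk'_zero]
    rw [IsLocalization.map_eq_zero_iff (irrelevant R).primeCompl] at h0
    obtain ⟨s, hs⟩ := h0
    exact s.2 ((hg s).2 hs)

end Local

end AssociatedGraded

/-! ### Generic linear forms avoid the associated primes. -/

section ZariskiOpen

variable {k V : Type u} [Field k] [AddCommGroup V] [Module k V]

theorem isZariskiOpen_setOf_forall_dual_ne_zero {ι : Type u} [Finite ι]
    (φ : ι → Module.Dual k V) : IsZariskiOpen k {v | ∀ i, φ i v ≠ 0} := by
  have := Fintype.ofFinite ι
  refine ⟨{∏ i, (φ i : V → k)}, ?_, ?_⟩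
  · rw [Set.singleton_subset_iff]
    exact prod_mem fun i _ ↦ Algebra.subset_adjoin ⟨φ i, rfl⟩
  · ext v
    simp [Finset.prod_eq_zero_iff]

end ZariskiOpen

namespace AssociatedGraded

variable {R : Type u} [CommRing R] [IsLocalRing R]

/-- The classes in the cotangent space whose degree one forms lie in a given ideal. -/
def cotangentSubspace (P : Ideal (AssociatedGraded (maximalIdeal R))) :
    Submodule (ResidueField R) (CotangentSpace R) where
  carrier := {v | ∃ x, (maximalIdeal R).toCotangent x = v ∧ degreeOne x ∈ P}
  add_mem' := by
    rintro _ _ ⟨x, rfl, hx⟩ ⟨y, rfl, hy⟩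
    exact ⟨x + y, map_add _ _ _, by rw [degreeOne_add]; exact add_mem hx hy⟩
  zero_mem' := ⟨0, map_zero _, by
    rw [degreeOne_eq_zero_iff.2 (by simp)]
    exact zero_mem _⟩
  smul_mem' := by
    rintro c _ ⟨x, rfl, hx⟩
    obtain ⟨a, rfl⟩ := residue_surjective c
    exact ⟨a • x, map_smul _ _ _, by rw [degreeOne_smul]; exact P.mul_mem_left _ hx⟩

/-- Membership is independent of the representative because `degreeOne` kills `m²`. -/
theorem toCotangent_mem_cotangentSubspace {P : Ideal (AssociatedGraded (maximalIdeal R))}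
    {x : maximalIdeal R} :
    (maximalIdeal R).toCotangent x ∈ cotangentSubspace P ↔ degreeOne x ∈ P := by
  refine ⟨?_, fun h ↦ ⟨x, rfl, h⟩⟩
  rintro ⟨y, hy, hyP⟩
  have h0 : degreeOne (x - y) = 0 := by
    rw [degreeOne_eq_zero_iff]
    exact Ideal.toCotangent_eq _ |>.1 hy.symm
  rw [← sub_add_cancel x y, degreeOne_add, h0, zero_add]
  exact hyP

theorem cotangentSubspace_ne_top [IsNoetherianRing R] (hdim : ringKrullDim R ≠ 0)
    (hGr : IsCMRing (AssociatedGraded (maximalIdeal R)))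
    {P : Ideal (AssociatedGraded (maximalIdeal R))}
    (hP : P ∈ associatedPrimes (AssociatedGraded (maximalIdeal R))
      (AssociatedGraded (maximalIdeal R))) : cotangentSubspace P ≠ ⊤ := by
  intro htop
  have hle : irrelevant R ≤ P := irrelevant_le fun x ↦ by
    rw [← toCotangent_mem_cotangentSubspace, htop]
    trivial
  have hPp : P.IsPrime := hP.1
  have heq := (inferInstance : (irrelevant R).IsMaximal).eq_of_le hPp.ne_top hle
  exact irrelevant_notMem_associatedPrimes hdim hGr (heq ▸ hP)

theorem exists_isZariskiOpen_hasRegularInitialForm [IsNoetherianRing R]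
    [Infinite (ResidueField R)] (hdim : ringKrullDim R ≠ 0)
    (hGr : IsCMRing (AssociatedGraded (maximalIdeal R))) :
    ∃ U : Set (CotangentSpace R), IsZariskiOpen (ResidueField R) U ∧ U.Nonempty ∧
      ∀ x : maximalIdeal R, (maximalIdeal R).toCotangent x ∈ U →
        HasRegularInitialForm (x : R) := by
  let A := AssociatedGraded (maximalIdeal R)
  have : Finite (associatedPrimes A A) := (associatedPrimes.finite A A).to_subtype
  -- Each proper subspace is enlarged to a hyperplane, so one product of linear forms cuts out the
  -- union.
  choose φ hφ0 hφ using fun P : associatedPrimes A A ↦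
    Submodule.exists_le_ker_of_lt_top _ (cotangentSubspace_ne_top hdim hGr P.2).lt_top
  refine ⟨{v | ∀ P, φ P v ≠ 0}, isZariskiOpen_setOf_forall_dual_ne_zero φ,
    Module.Dual.exists_forall_ne_zero_of_forall_exists φ fun P ↦ ?_, fun x hx ↦ ?_⟩
  · by_contra! h
    exact hφ0 P (LinearMap.ext h)
  · apply hasRegularInitialForm_of_mem_nonZeroDivisors
    by_contra hzd
    have hmem : degreeOne x ∈ ⋃ P ∈ associatedPrimes A A, (P : Set A) := by
      rw [biUnion_associatedPrimes_eq_compl_nonZeroDivisors]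
      exact hzd
    obtain ⟨P, hP, hxP⟩ := Set.mem_iUnion₂.1 hmem
    exact hx ⟨P, hP⟩ (hφ ⟨P, hP⟩ (toCotangent_mem_cotangentSubspace.2 hxP))

end AssociatedGraded

theorem corollary3p8 (R : Type u) [CommRing R] [IsLocalRing R]
    (hCM : IsCMLocalRing R) (hdim : ringKrullDim R = 1)
    (hk : Infinite (ResidueField R))
    (hGr : IsCMRing (AssocGradedRing (maximalIdeal R))) :
    (∃ x ∈ maximalIdeal R, IsGllWitness [x] ∧
      IsReduction (Ideal.span {x}) (maximalIdeal R) ∧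
      reductionNumber (Ideal.span {x}) (maximalIdeal R) = ulr R) ∧
    (∃ U : Set (CotangentSpace R), IsZariskiOpen (ResidueField R) U ∧ U.Nonempty ∧
      ∀ x : maximalIdeal R, (maximalIdeal R).toCotangent x ∈ U → IsGllWitness [(x : R)]) := by
  have := hCM.noetherian
  obtain ⟨U, hU, hne, h⟩ := AssociatedGraded.exists_isZariskiOpen_hasRegularInitialForm
    (by rw [hdim]; exact one_ne_zero) hGr
  refine ⟨?_, U, hU, hne, fun x hx ↦ (h x hx).isGllWitness hdim⟩
  obtain ⟨v, hv⟩ := hne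
  obtain ⟨x, rfl⟩ := (maximalIdeal R).toCotangent_surjective v
  have hx := h x hv
  exact ⟨x, x.2, hx.isGllWitness hdim,
    ⟨(Ideal.span_singleton_le_iff_mem _).2 x.2, hx.exists_pow_succ_eq hdim⟩,
    hx.reductionNumber_eq hdim⟩
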